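/- **Setting.** Let $V$ be a finite vertex set with $n=|V|$, with a distinguished vertex $0\in V$, and let $H=(V,E,w)$ be a finite directed hypergraph: each $e\in E$ has a nonempty tail $\mathsf T_e\subseteq V$, a nonempty head $\mathsf H_e\subseteq V$ and a weight $w_e\ge 0$. Let $\kappa\ge 1$, let the vertex weights $\omega:V\to\mathbb R$ satisfy $1\le\omega_i\le\kappa$ for all $i$, and put $W=\sum_{i\in V}\omega_i$. For matrices in $\mathbb R^{V\times V}$ write $A\bullet B=\mathrm{Tr}(A^{\mathsf T}B)$. With $L_{ij}=(e_i-e_j)(e_i-e_j)^{\mathsf T}$ (so that $L_{ij}\bullet X=\|v_i-v_j\|^2$ if $X$ is the Gram matrix of vectors $(v_i)_{i\in V}$), put $$A_{ij}=L_{ij}-L_{i0}+L_{j0},\qquad K=\sum_{\{i,j\}\in\binom V2}\omega_i\omega_jL_{ij},\qquad T_p=L_{ij}+L_{jk}-L_{ik}\ \text{ for } p=(\{i,k\},j)\in\mathcal T,$$ where $\mathcal T$ is the set of all pairs $(\{i,k\},j)$ with $i,j,k\in V$ distinct. **SDP.** Minimize $\frac12\sum_{e\in E}w_ed_e$ over all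 $X\succeq0$ and $d\in\mathbb R^E$ subject to $d_e\ge A_{ij}\bullet X$ for all $e\in E$ and $(i,j)\in\mathsf T_e\times\mathsf H_e$; $T_p\bullet X\ge0$ for all $p\in\mathcal T$; $K\bullet X=1$; and $d_e\ge0$ for all $e\in E$. The optimal value is the infimum ($+\infty$ if there is no feasible solution, which happens only if $n=1$). A matrix $X\succeq0$ with $K\bullet X=1$ and $T_p\bullet X\ge0$ for all $p\in\mathcal T$ is called primal feasible. **Oracle.** Let $\alpha>0$ and $\rho>0$. An oracle for $\alpha$ has width $\rho$ if, given any $X\succeq0$ with $K\bullet X=1$, it outputs either (i) a set $\emptyset\ne S\subsetneq V$ with $$\frac{w(\partial^+(S))}{\omega(S)\,\omega(V\setminus S)}\le C\sqrt{\log(\kappa n)}\cdot\alpha,$$ where $\partial^+(S)=\{e\in E:\mathsf T_e\cap S\ne\emptyset,\ \mathsf H_e\setminus S\neq\emptyset\}$ and $C$ is a fixed constant, or (ii) a number $z\ge\alpha$, numbers $f_p\ge0$ $(p\in\mathcal T)$ and a symmetric matrix $F\in\mathbb R^{V\times V}$ such that - $\big(\sum_pf_pT_p+zK\big)\bullet X\le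 F\bullet X$; - $F\bullet X^*\le\frac12\sum_{e\in E}w_ed^*_e$ for every primal feasible $X^*$, where $d^*_e=\max\{0,\max_{(i,j)\in\mathsf T_e\times\mathsf H_e}A_{ij}\bullet X^*\}$; - $Fx=0$ for all $x\in\mathrm{span}\{\mathbf 1\}$; - the spectral norm of $\sum_pf_pT_p+zK-F$ is at most $\rho$. The oracle may be deterministic, randomized or stateful. **Algorithm.** Let $$T=\left\lceil\frac{16\,\kappa^2\rho^2n^2\ln n}{\alpha^2W^4}\right\rceil,\qquad \eta=\sqrt{\frac{\ln n}{T}},\qquad W^{(1)}=I.$$ In iteration $t=1,\dots,T$, run the oracle on $X^{(t)}=W^{(t)}/(K\bullet W^{(t)})$. If it returns a subset $S$, stop and return $S$. Otherwise it returns $(z^{(t)},(f^{(t)}_p)_p,F^{(t)})$ as in (ii); put $$M^{(t)}=-\tfrac1\rho\Big(\sum_pf^{(t)}_pT_p+z^{(t)}K-F^{(t)}\Big),\qquad W^{(t+1)}=\exp\Big(-\eta\sum_{\tau=1}^tM^{(\tau)}\Big).$$ **Lemma (Correctness).** If the oracle has width $\rho$ and does not return a subset in any of the $T$ iterations of the algorithm,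 then the optimal value of the SDP is at least $\alpha/2$. -/

import Mathlib

open Matrix

noncomputable section

namespace DirSparsestCut

/-- An edge-weighted directed hypergraph with vertex set `V` and hyperedges indexed by `E`;
the hyperedge `e` points from its tail set to its head set, both nonempty
(and not necessarily disjoint), and has weight `w e ≥ 0`. -/
structure DirectedHypergraph (V E : Type*) where
  tail : E → Finset V
  head : E → Finset V
  tail_nonempty : ∀ e, (tail e).Nonempty
  head_nonempty : ∀ e, (head e).Nonempty
  w : E → ℝ
  w_nonneg : ∀ e, 0 ≤ w e

/-- The vertex weights `ω` are `κ`-skewed. -/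
def IsSkewed {V : Type*} (κ : ℝ) (ω : V → ℝ) : Prop :=
  ∀ i, 1 ≤ ω i ∧ ω i ≤ κ

/-- Triples `({i, k}, j)` with `i, j, k` distinct; they index the `ℓ₂²`-triangle inequalities
`‖v i - v k‖² ≤ ‖v i - v j‖² + ‖v j - v k‖²`. -/
abbrev Triple (V : Type*) : Type _ :=
  {p : Sym2 V × V // ¬ p.1.IsDiag ∧ p.2 ∉ p.1}

section Matrices

set_option linter.unusedSectionVars false

variable {V : Type*} [Fintype V] [DecidableEq V]

/-- `A • B = Tr(Aᵀ B)`. -/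
def bullet (A B : Matrix V V ℝ) : ℝ := (Aᵀ * B).trace

/-- The spectral norm (the operator norm for the Euclidean norm). -/
def spectralNorm (A : Matrix V V ℝ) : ℝ := ‖Matrix.toEuclideanCLM (𝕜 := ℝ) A‖

/-- The symmetric matrix `(e_i - e_j)(e_i - e_j)ᵀ`, which represents `‖v i - v j‖²`
(see `bullet_sqDistMatrix`). -/
def sqDistMatrix (i j : V) : Matrix V V ℝ :=
  Matrix.vecMulVec (Pi.single i 1 - Pi.single j 1) (Pi.single i 1 - Pi.single j 1)

theorem sqDistMatrix_comm (i j : V) : sqDistMatrix i j = sqDistMatrix j i := by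
  ext a b
  simp only [sqDistMatrix, Matrix.vecMulVec_apply, Pi.sub_apply]
  ring

/-- If `X` is the Gram matrix of the vectors `v`, then `sqDistMatrix i j • X = ‖v i - v j‖²`. -/
theorem bullet_sqDistMatrix {F : Type*} [NormedAddCommGroup F] [InnerProductSpace ℝ F]
    (v : V → F) (i j : V) :
    bullet (sqDistMatrix i j) (Matrix.of fun a b => inner ℝ (v a) (v b)) =
      ‖v i - v j‖ ^ 2 := by
  have h : ∀ X : Matrix V V ℝ,
      bullet (sqDistMatrix i j) X = X i i - X i j - X j i + X j j := by
    intro X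
    rw [bullet, sqDistMatrix, Matrix.transpose_vecMulVec, Matrix.vecMulVec_mul,
      Matrix.trace_vecMulVec, dotProduct_comm, ← Matrix.dotProduct_mulVec]
    simp [Matrix.mulVec_sub, sub_dotProduct]
    ring
  rw [h, norm_sub_sq_real]
  simp only [Matrix.of_apply, real_inner_self_eq_norm_sq, real_inner_comm (v i) (v j)]
  ring

/-- `A_ij`, representing the directed distance
`d(i, j) = ‖v i - v j‖² - ‖v i - v o‖² + ‖v j - v o‖²` with respect to the root `o`. -/
def dirDistMatrix (o i j : V) : Matrix V V ℝ :=
  sqDistMatrix i j - sqDistMatrix i o + sqDistMatrix j o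

/-- `T_p` for `p = ({i, k}, j)`, representing `‖v i - v j‖² + ‖v j - v k‖² - ‖v i - v k‖²`. -/
def triMatrix (p : Triple V) : Matrix V V ℝ :=
  Sym2.lift
    ⟨fun i k => sqDistMatrix i p.1.2 + sqDistMatrix p.1.2 k - sqDistMatrix i k, fun i k => by
      dsimp only
      rw [sqDistMatrix_comm i k, sqDistMatrix_comm i p.1.2, sqDistMatrix_comm p.1.2 k, add_comm]⟩
    p.1.1

/-- `K`, representing the sum of `ω i * ω j * ‖v i - v j‖²` over unordered pairs `{i, j}`
(half of the sum over ordered pairs; the terms with `i = j` vanish). -/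
def demandMatrix (ω : V → ℝ) : Matrix V V ℝ :=
  (1 / 2 : ℝ) • ∑ i, ∑ j, (ω i * ω j) • sqDistMatrix i j

/-- A dual solution `(z, (f_p)_p)` together with a matrix `F`. -/
structure DualSolution (V : Type*) where
  z : ℝ
  f : Triple V → ℝ
  F : Matrix V V ℝ

/-- `∑_p f_p T_p + z K - F`. -/
def DualSolution.slack (ω : V → ℝ) (D : DualSolution V) : Matrix V V ℝ :=
  (∑ p, D.f p • triMatrix p) + D.z • demandMatrix ω - D.F

/-- What the oracle may answer: a subset of the vertices, or a dual solution. -/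
inductive OracleOutput (V : Type*) where
  | subset (S : Finset V) : OracleOutput V
  | dual (D : DualSolution V) : OracleOutput V

/-- An oracle assigns to each candidate matrix the set of its possible answers
(one answer for a deterministic oracle, several for a randomized or a stateful one). -/
abbrev Oracle (V : Type*) : Type _ := Matrix V V ℝ → Set (OracleOutput V)

/-- The constraints of the SDP on the matrix variable `X`. -/
structure PrimalFeasible (ω : V → ℝ) (X : Matrix V V ℝ) : Prop where
  posSemidef : X.PosSemidef
  triangle : ∀ p : Triple V, 0 ≤ bullet (triMatrix p) X
  sum_one : bullet (demandMatrix ω) X = 1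

end Matrices

namespace DirectedHypergraph

variable {V E : Type*} [Fintype V] [DecidableEq V] [Fintype E]

/-- Feasible solutions `(X, d)` of the SDP. -/
structure SDPFeasible (H : DirectedHypergraph V E) (ω : V → ℝ) (o : V)
    (X : Matrix V V ℝ) (d : E → ℝ) : Prop where
  primal : PrimalFeasible ω X
  dist_le : ∀ e, ∀ i ∈ H.tail e, ∀ j ∈ H.head e, 0 ≤ d e - bullet (dirDistMatrix o i j) X
  nonneg : ∀ e, 0 ≤ d e

/-- The objective function of the SDP. -/
def objective (H : DirectedHypergraph V E) (d : E → ℝ) : ℝ :=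
  (1 / 2 : ℝ) * ∑ e, H.w e * d e

/-- The optimal value of the SDP: the infimum of the objective over all feasible solutions
(`⊤` if there is none, which happens only when `V` has a single vertex). -/
def sdpValue (H : DirectedHypergraph V E) (ω : V → ℝ) (o : V) : EReal :=
  ⨅ (X : Matrix V V ℝ) (d : E → ℝ) (_ : H.SDPFeasible ω o X d), (H.objective d : EReal)

/-- `d_e = max {0, max_{(i,j) ∈ tail e × head e} A_ij • X}`. -/
def inducedDist (H : DirectedHypergraph V E) (o : V) (X : Matrix V V ℝ) (e : E) : ℝ :=
  max 0 ((H.tail e ×ˢ H.head e).sup' ((H.tail_nonempty e).product (H.head_nonempty e))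
    fun q => bullet (dirDistMatrix o q.1 q.2) X)

/-- The weight of the out-going cut of `S`: the hyperedges whose tail meets `S` and whose head
meets the complement of `S`. -/
def outCutWeight (H : DirectedHypergraph V E) (S : Finset V) : ℝ :=
  ∑ e with (H.tail e ∩ S).Nonempty ∧ (H.head e ∩ Sᶜ).Nonempty, H.w e

/-- The directed sparsity of `S` with product demands. -/
def sparsity (H : DirectedHypergraph V E) (ω : V → ℝ) (S : Finset V) : ℝ :=
  H.outCutWeight S / ((∑ i ∈ S, ω i) * ∑ i ∈ Sᶜ, ω i)

/-- The conditions on a dual solution that an oracle of width `ρ` may return on input `X`. -/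
structure GoodDual (H : DirectedHypergraph V E) (ω : V → ℝ) (o : V) (α ρ : ℝ)
    (X : Matrix V V ℝ) (D : DualSolution V) : Prop where
  f_nonneg : ∀ p, 0 ≤ D.f p
  F_symm : D.F.IsSymm
  z_ge : α ≤ D.z
  bullet_le : bullet ((∑ p, D.f p • triMatrix p) + D.z • demandMatrix ω) X ≤ bullet D.F X
  F_le : ∀ X' : Matrix V V ℝ, PrimalFeasible ω X' →
    bullet D.F X' ≤ H.objective (H.inducedDist o X')
  F_ones : ∀ x ∈ Submodule.span ℝ {(1 : V → ℝ)}, D.F *ᵥ x = 0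
  norm_le : spectralNorm (D.slack ω) ≤ ρ

/-- The subsets that the oracle may return; `C` is the constant in `O(√(log κn))`. -/
structure GoodSubset (H : DirectedHypergraph V E) (ω : V → ℝ) (κ C α : ℝ) (S : Finset V) :
    Prop where
  nonempty : S.Nonempty
  ne_univ : S ≠ Finset.univ
  sparsity_le : H.sparsity ω S ≤ C * √(Real.log (κ * Fintype.card V)) * α

/-- `O` is an oracle for the candidate value `α` that has width `ρ`: on each input `X ⪰ 0` with
`K • X = 1` it answers, and each answer is a sparse subset or a good dual solution. -/
def HasWidth (H : DirectedHypergraph V E) (ω : V → ℝ) (o : V) (κ C α ρ : ℝ) (O : Oracle V) :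
    Prop :=
  ∀ X : Matrix V V ℝ, X.PosSemidef → bullet (demandMatrix ω) X = 1 →
    (O X).Nonempty ∧
    (∀ S, OracleOutput.subset S ∈ O X → H.GoodSubset ω κ C α S) ∧
    (∀ D, OracleOutput.dual D ∈ O X → H.GoodDual ω o α ρ X D)

end DirectedHypergraph

section Algorithm

variable {V : Type*} [Fintype V] [DecidableEq V]

/-- The number of iterations, `⌈16 κ² ρ² n² ln n / (α² ω(V)⁴)⌉`. -/
def numIter (ω : V → ℝ) (κ α ρ : ℝ) : ℕ :=
  ⌈16 * κ ^ 2 * ρ ^ 2 * (Fintype.card V : ℝ) ^ 2 * Real.log (Fintype.card V) /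
    (α ^ 2 * (∑ i, ω i) ^ 4)⌉₊

/-- The step size `η = √(ln n / T)`. -/
def stepSize (V : Type*) [Fintype V] (T : ℕ) : ℝ :=
  √(Real.log (Fintype.card V) / T)

/-- `M = -(1/ρ) (∑_p f_p T_p + z K - F)`. -/
def lossMatrix (ω : V → ℝ) (ρ : ℝ) (D : DualSolution V) : Matrix V V ℝ :=
  (-(1 / ρ)) • D.slack ω

/-- The weight matrix computed from the first `t` dual solutions `D 0, …, D (t - 1)`:
`exp (-η ∑_{s < t} M_s)`, which is the identity matrix for `t = 0`. -/
def weightMatrix (ω : V → ℝ) (ρ η : ℝ) (D : ℕ → DualSolution V) (t : ℕ) : Matrix V V ℝ :=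
  NormedSpace.exp (-(η • ∑ s ∈ Finset.range t, lossMatrix ω ρ (D s)))

/-- The primal candidate `W / (K • W)` computed from the first `t` dual solutions. -/
def primalCandidate (ω : V → ℝ) (ρ η : ℝ) (D : ℕ → DualSolution V) (t : ℕ) : Matrix V V ℝ :=
  (bullet (demandMatrix ω) (weightMatrix ω ρ η D t))⁻¹ • weightMatrix ω ρ η D t

/-- `D 0, …, D (T - 1)` are the answers of the oracle `O` in a run of `T` iterations of the
primal-dual algorithm in which the oracle never returns a subset. -/
def IsSubsetFreeRun (ω : V → ℝ) (ρ : ℝ) (O : Oracle V) (T : ℕ) (D : ℕ → DualSolution V) :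
    Prop :=
  ∀ t < T, OracleOutput.dual (D t) ∈ O (primalCandidate ω ρ (stepSize V T) D t)

end Algorithm

end DirSparsestCut

end

/-! This is weak duality averaged over matrix multiplicative weights. Let `S_t` be the slack matrix
of the answer in iteration t. Pairing `S_t` with a feasible `X` gives at least `α` minus the
objective (`sub_objective_le`), so it is enough to bound the average of `S_t • X` by `α / 2`.

The oracle makes `S_t • W_t ≤ 0`, so the potential `Tr W_t` grows by a factor of at most `1 + η²`
per iteration (`trace_exp_add_le`). In place of Golden–Thompson, a scalar Taylor bound is summed
over pairs of eigenvectors of the two exponents (`trace_exp_sub_le`). As `η² T = ln n`, the final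
trace is at most `exp (2 η² T)`, which bounds every eigenvalue of `(η / ρ) ∑ S_t` by `2 η² T`.

The slacks annihilate the all-ones vector, so `X` may be centered at its `ω`-weighted mean. Then `K
• X = 1` forces trace at most `1 / W`, and an eigenvalue bound `c` becomes `c / W`
(`bullet_le_of_posSemidef`). The average is thus at most `2 η ρ / W`, and `T` is chosen to make this
at most `α / 2`. -/

noncomputable section

namespace DirSparsestCut

set_option linter.unusedSectionVars false

/-! ### Scalar Taylor bounds -/

section Exponential

/-- A second order Taylor estimate for the exponential function on the whole real line. -/
theorem exp_le_one_add_add_sq_mul (x : ℝ) :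
    Real.exp x ≤ 1 + x + x ^ 2 * (Real.exp x / 4 + 1 / 2) := by
  rcases le_or_gt 0 x with hx | hx
  · have h1 : 1 ≤ Real.exp x := Real.one_le_exp hx
    -- `log (1 + y) ≥ 2y / (y + 2)` at `y = exp x - 1`; multiplying by `2 + x` below cancels the
    -- mixed term `x * exp x`.
    have h := Real.le_log_one_add_of_nonneg (sub_nonneg.2 h1)
    rw [add_sub_cancel, Real.log_exp, div_le_iff₀ (by linarith)] at h
    nlinarith [mul_nonneg (sub_nonneg.2 h) (by linarith : (0 : ℝ) ≤ 2 + x), sq_nonneg x]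
  · have h := Real.quadratic_le_exp_of_nonneg (neg_nonneg.2 hx.le)
    have hp := Real.exp_pos x
    have hm : Real.exp x * Real.exp (-x) = 1 := by rw [← Real.exp_add]; simp
    have h2 : Real.exp x ≤ 1 + x + x ^ 2 / 2 := by
      have h3 : 0 < 1 + -x + (-x) ^ 2 / 2 := by nlinarith
      refine le_of_mul_le_mul_right ?_ h3
      -- `(1 + x + x²/2)(1 - x + x²/2) = 1 + x⁴/4 ≥ 1`.
      nlinarith [mul_le_mul_of_nonneg_left h hp.le, sq_nonneg (x ^ 2)]
    nlinarith [mul_nonneg (sq_nonneg x) hp.le]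

/-- Each term is a polynomial times `exp a` alone or `exp b` alone, so it lifts to traces of two
noncommuting matrices. -/
theorem exp_sub_exp_le (a b : ℝ) :
    Real.exp a - Real.exp b - (a - b) * Real.exp b ≤
      (a - b) ^ 2 * (Real.exp a / 4 + Real.exp b / 2) := by
  have h := mul_le_mul_of_nonneg_right (exp_le_one_add_add_sq_mul (a - b)) (Real.exp_pos b).le
  have e : Real.exp (a - b) * Real.exp b = Real.exp a := by rw [← Real.exp_add]; simp
  linear_combination h + ((a - b) ^ 2 / 4 - 1) * e

end Exponential

/-! ### Spectral decompositions and the trace exponential -/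

section SpectralCalculus

variable {V : Type*} [Fintype V] [DecidableEq V]

/-- The matrix with eigenvalues `a` and the columns of `U` as eigenvectors. -/
def conjDiag (U : Matrix V V ℝ) (a : V → ℝ) : Matrix V V ℝ := U * diagonal a * Uᵀ

theorem exists_eq_conjDiag {A : Matrix V V ℝ} (hA : A.IsHermitian) :
    ∃ (U : Matrix V V ℝ) (a : V → ℝ), Uᵀ * U = 1 ∧ A = conjDiag U a := by
  refine ⟨hA.eigenvectorUnitary, hA.eigenvalues, ?_, ?_⟩
  · have := Unitary.coe_star_mul_self hA.eigenvectorUnitary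
    rwa [star_eq_conjTranspose, conjTranspose_eq_transpose_of_trivial] at this
  · have := hA.spectral_theorem
    rwa [Unitary.conjStarAlgAut_apply, star_eq_conjTranspose,
      conjTranspose_eq_transpose_of_trivial] at this

theorem conjDiag_mul {U : Matrix V V ℝ} (hU : Uᵀ * U = 1) (a b : V → ℝ) :
    conjDiag U a * conjDiag U b = conjDiag U (fun i => a i * b i) := by
  simp only [conjDiag]
  calc U * diagonal a * Uᵀ * (U * diagonal b * Uᵀ)
      = U * diagonal a * (Uᵀ * U) * diagonal b * Uᵀ := by simp only [Matrix.mul_assoc]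
    _ = _ := by rw [hU, Matrix.mul_one, Matrix.mul_assoc U, diagonal_mul_diagonal]

theorem conjDiag_const {U : Matrix V V ℝ} (hU : Uᵀ * U = 1) (c : ℝ) :
    conjDiag U (fun _ => c) = c • 1 := by
  have h : diagonal (fun _ : V => c) = c • (1 : Matrix V V ℝ) := by
    rw [← diagonal_one, ← diagonal_smul]; congr 1; ext; simp
  simp [conjDiag, h, mul_eq_one_comm.1 hU]

theorem conjDiag_sub (U : Matrix V V ℝ) (a b : V → ℝ) :
    conjDiag U a - conjDiag U b = conjDiag U (fun i => a i - b i) := by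
  simp [conjDiag, ← Matrix.sub_mul, ← Matrix.mul_sub, diagonal_sub]

theorem exp_conjDiag {U : Matrix V V ℝ} (hU : Uᵀ * U = 1) (a : V → ℝ) :
    NormedSpace.exp (conjDiag U a) = conjDiag U (fun i => Real.exp (a i)) := by
  have hu : IsUnit U := IsUnit.of_mul_eq_one _ (mul_eq_one_comm.1 hU)
  have hi : U⁻¹ = Uᵀ := inv_eq_left_inv hU
  rw [conjDiag, ← hi, exp_conj _ _ hu, exp_diagonal, hi, conjDiag]
  congr 3
  ext i
  rw [Pi.coe_exp, Real.exp_eq_exp_ℝ]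

theorem posSemidef_conjDiag {U : Matrix V V ℝ} {a : V → ℝ} (ha : ∀ i, 0 ≤ a i) :
    (conjDiag U a).PosSemidef := by
  have := (PosSemidef.diagonal (d := a) ha).mul_mul_conjTranspose_same U
  rwa [conjTranspose_eq_transpose_of_trivial] at this

theorem trace_mul_conjDiag (A U : Matrix V V ℝ) (a : V → ℝ) :
    (A * conjDiag U a).trace = ∑ i, (Uᵀ * A * U) i i * a i := by
  rw [conjDiag, ← Matrix.mul_assoc, Matrix.trace_mul_comm, ← Matrix.mul_assoc, ← Matrix.mul_assoc]
  simp [Matrix.trace, Matrix.mul_diagonal]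

/-- The weights are squared inner products of columns of `U'` and `U`. Being nonnegative, they let
scalar inequalities in `(a j, b i)` pass to traces. -/
theorem trace_conjDiag_mul_conjDiag (U U' : Matrix V V ℝ) (a b : V → ℝ) :
    (conjDiag U a * conjDiag U' b).trace =
      ∑ i, ∑ j, (U'ᵀ * U) i j ^ 2 * (a j * b i) := by
  rw [trace_mul_conjDiag]
  refine Finset.sum_congr rfl fun i _ => ?_
  have : U'ᵀ * conjDiag U a * U' = (U'ᵀ * U) * diagonal a * (U'ᵀ * U)ᵀ := by
    simp only [conjDiag, transpose_mul, transpose_transpose, Matrix.mul_assoc]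
  rw [this, Matrix.mul_apply, Finset.sum_mul]
  refine Finset.sum_congr rfl fun j _ => ?_
  rw [mul_diagonal, transpose_apply]
  ring

theorem trace_mul_nonneg {A B : Matrix V V ℝ} (hA : A.PosSemidef) (hB : B.PosSemidef) :
    0 ≤ (A * B).trace := by
  obtain ⟨U, b, hU, rfl⟩ := exists_eq_conjDiag hB.1
  have key : ∀ {M : Matrix V V ℝ}, M.PosSemidef → ∀ i, 0 ≤ (Uᵀ * M * U) i i := fun hM i => by
    have := hM.conjTranspose_mul_mul_same U
    rw [conjTranspose_eq_transpose_of_trivial] at this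
    exact this.diag_nonneg
  have hb : ∀ i, 0 ≤ b i := fun i => by
    have h := key hB i
    have e : Uᵀ * conjDiag U b * U = diagonal b := by
      calc Uᵀ * conjDiag U b * U = Uᵀ * U * diagonal b * (Uᵀ * U) := by
            simp only [conjDiag, Matrix.mul_assoc]
        _ = _ := by rw [hU]; simp
    rwa [e, diagonal_apply_eq] at h
  rw [trace_mul_conjDiag]
  exact Finset.sum_nonneg fun i _ => mul_nonneg (key hA i) (hb i)

theorem posDef_exp {A : Matrix V V ℝ} (hA : A.IsHermitian) : (NormedSpace.exp A).PosDef := by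
  have hps : (NormedSpace.exp A).PosSemidef := by
    obtain ⟨U, a, hU, rfl⟩ := exists_eq_conjDiag hA
    rw [exp_conjDiag hU]
    exact posSemidef_conjDiag fun i => (Real.exp_pos _).le
  exact hps.posDef_iff_isUnit.2 (isUnit_exp A)

/-- A second order Taylor estimate for the trace exponential. -/
theorem trace_exp_sub_le {A B : Matrix V V ℝ} (hA : A.IsHermitian) (hB : B.IsHermitian) :
    (NormedSpace.exp A).trace - (NormedSpace.exp B).trace -
        ((A - B) * NormedSpace.exp B).trace ≤
      ((A - B) * (A - B) * NormedSpace.exp A).trace / 4 +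
        ((A - B) * (A - B) * NormedSpace.exp B).trace / 2 := by
  obtain ⟨U, a, hU, hAU⟩ := exists_eq_conjDiag hA
  obtain ⟨U', b, hU', hBU⟩ := exists_eq_conjDiag hB
  set Q := U'ᵀ * U
  have one₁ : conjDiag U (fun _ => 1) = 1 := by rw [conjDiag_const hU, one_smul]
  have one₂ : conjDiag U' (fun _ => 1) = 1 := by rw [conjDiag_const hU', one_smul]
  have eA : NormedSpace.exp A = conjDiag U fun i => Real.exp (a i) := by
    rw [hAU, exp_conjDiag hU]
  have eB : NormedSpace.exp B = conjDiag U' fun i => Real.exp (b i) := by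
    rw [hBU, exp_conjDiag hU']
  -- A function of one matrix is paired with the identity, written in the other eigenbasis, so that
  -- all traces become sums with the same weights.
  have t1 : (NormedSpace.exp A).trace = ∑ i, ∑ j, Q i j ^ 2 * (Real.exp (a j) * 1) := by
    rw [← trace_conjDiag_mul_conjDiag, one₂, Matrix.mul_one, eA]
  have t2 : (NormedSpace.exp B).trace = ∑ i, ∑ j, Q i j ^ 2 * (1 * Real.exp (b i)) := by
    rw [← trace_conjDiag_mul_conjDiag U U' (fun _ => 1), one₁, Matrix.one_mul, eB]
  have t3 : ((A - B) * NormedSpace.exp B).trace =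
      (∑ i, ∑ j, Q i j ^ 2 * (a j * Real.exp (b i))) -
        ∑ i, ∑ j, Q i j ^ 2 * (1 * (b i * Real.exp (b i))) := by
    rw [← trace_conjDiag_mul_conjDiag, ← trace_conjDiag_mul_conjDiag U U' (fun _ => 1), one₁,
      Matrix.one_mul, ← conjDiag_mul hU' b, ← eB, ← hAU, ← hBU, Matrix.sub_mul, trace_sub]
  have t4 : ((A - B) * (A - B) * NormedSpace.exp A).trace =
      (∑ i, ∑ j, Q i j ^ 2 * (a j * (a j * Real.exp (a j)) * 1)) -
        2 * (∑ i, ∑ j, Q i j ^ 2 * (a j * Real.exp (a j) * b i)) +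
        ∑ i, ∑ j, Q i j ^ 2 * (Real.exp (a j) * (b i * b i)) := by
    rw [← trace_conjDiag_mul_conjDiag, ← trace_conjDiag_mul_conjDiag,
      ← trace_conjDiag_mul_conjDiag, one₂, Matrix.mul_one, ← conjDiag_mul hU a,
      ← conjDiag_mul hU a, ← conjDiag_mul hU' b, ← eA, ← hAU, ← hBU]
    -- Together with cyclicity of the trace, this identifies the two cross terms, although `A` and
    -- `B` need not commute.
    have c : Commute A (NormedSpace.exp A) := by
      rw [eA, hAU, Commute, SemiconjBy, conjDiag_mul hU, conjDiag_mul hU]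
      simp only [mul_comm]
    have h1 : (A * B * NormedSpace.exp A).trace = (A * NormedSpace.exp A * B).trace := by
      rw [c.eq, Matrix.trace_mul_comm, Matrix.mul_assoc]
    have h2 : (B * A * NormedSpace.exp A).trace = (A * NormedSpace.exp A * B).trace := by
      rw [Matrix.mul_assoc, Matrix.trace_mul_comm]
    have h3 : (B * B * NormedSpace.exp A).trace = (NormedSpace.exp A * (B * B)).trace :=
      Matrix.trace_mul_comm _ _
    simp only [Matrix.sub_mul, Matrix.mul_sub, trace_sub, h1, h2, h3]
    rw [Matrix.mul_assoc A A]
    ring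
  have t5 : ((A - B) * (A - B) * NormedSpace.exp B).trace =
      (∑ i, ∑ j, Q i j ^ 2 * (a j * a j * Real.exp (b i))) -
        2 * (∑ i, ∑ j, Q i j ^ 2 * (a j * (b i * Real.exp (b i)))) +
        ∑ i, ∑ j, Q i j ^ 2 * (1 * (b i * (b i * Real.exp (b i)))) := by
    rw [← trace_conjDiag_mul_conjDiag, ← trace_conjDiag_mul_conjDiag,
      ← trace_conjDiag_mul_conjDiag U U' (fun _ => 1), one₁, Matrix.one_mul, ← conjDiag_mul hU a,
      ← conjDiag_mul hU' b, ← conjDiag_mul hU' b, ← conjDiag_mul hU' b, ← eB, ← hAU, ← hBU]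
    have c : Commute B (NormedSpace.exp B) := by
      rw [eB, hBU, Commute, SemiconjBy, conjDiag_mul hU', conjDiag_mul hU']
      simp only [mul_comm]
    have h1 : (B * A * NormedSpace.exp B).trace = (A * (B * NormedSpace.exp B)).trace := by
      rw [c.eq, Matrix.mul_assoc, Matrix.trace_mul_comm, Matrix.mul_assoc]
    simp only [Matrix.sub_mul, Matrix.mul_sub, trace_sub, h1]
    rw [Matrix.mul_assoc A B, Matrix.mul_assoc B B]
    ring
  rw [t1, t2, t3, t4, t5]
  simp only [Finset.mul_sum, Finset.sum_div, ← Finset.sum_sub_distrib, ← Finset.sum_add_distrib]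
  refine Finset.sum_le_sum fun i _ => Finset.sum_le_sum fun j _ => ?_
  linear_combination (mul_le_mul_of_nonneg_left (exp_sub_exp_le (a j) (b i)) (sq_nonneg (Q i j)))

theorem dotProduct_mulVec_le_of_spectralNorm_le {N : Matrix V V ℝ} {c : ℝ} (hN : spectralNorm N ≤ c)
    (x : V → ℝ) : N *ᵥ x ⬝ᵥ N *ᵥ x ≤ c ^ 2 * (x ⬝ᵥ x) ∧ x ⬝ᵥ N *ᵥ x ≤ c * (x ⬝ᵥ x) := by
  have h := (Matrix.toEuclideanCLM (𝕜 := ℝ) N).le_of_opNorm_le hN (WithLp.toLp 2 x)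
  have hs : ∀ y : V → ℝ, y ⬝ᵥ y = ‖WithLp.toLp 2 y‖ ^ 2 := fun y => by
    rw [EuclideanSpace.real_norm_sq_eq]; simp [dotProduct, sq]
  have hi : x ⬝ᵥ N *ᵥ x = inner ℝ (WithLp.toLp 2 x) (Matrix.toEuclideanCLM (𝕜 := ℝ) N
      (WithLp.toLp 2 x)) := by rw [inner_toEuclideanCLM]
  rw [hs, hs, hi, ← toEuclideanCLM_toLp]
  constructor
  · rw [← mul_pow]
    exact pow_le_pow_left₀ (norm_nonneg _) h 2
  · calc _ ≤ _ := real_inner_le_norm _ _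
      _ ≤ _ := mul_le_mul_of_nonneg_left h (norm_nonneg _)
      _ = _ := by ring

theorem posSemidef_smul_one_sub {N : Matrix V V ℝ} (hN : N.IsHermitian) {c : ℝ}
    (h : spectralNorm N ≤ c) : (c • (1 : Matrix V V ℝ) - N).PosSemidef := by
  refine .of_dotProduct_mulVec_nonneg ((isHermitian_one.smul (.all c)).sub hN) fun x => ?_
  have := (dotProduct_mulVec_le_of_spectralNorm_le h x).2
  simp only [star_trivial, sub_mulVec, smul_mulVec, one_mulVec, dotProduct_sub, dotProduct_smul,
    smul_eq_mul]
  linarith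

theorem trace_mul_self_mul_le {N P : Matrix V V ℝ} (hN : N.IsHermitian) {c : ℝ}
    (h : spectralNorm N ≤ c) (hP : P.PosSemidef) : (N * N * P).trace ≤ c ^ 2 * P.trace := by
  have hps : (c ^ 2 • (1 : Matrix V V ℝ) - N * N).PosSemidef := by
    refine .of_dotProduct_mulVec_nonneg ((isHermitian_one.smul (.all _)).sub ?_) fun x => ?_
    · rw [IsHermitian, conjTranspose_mul, hN.eq]
    · have := (dotProduct_mulVec_le_of_spectralNorm_le h x).1
      have e : x ⬝ᵥ (N * N) *ᵥ x = N *ᵥ x ⬝ᵥ N *ᵥ x := by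
        rw [← mulVec_mulVec, dotProduct_mulVec, ← mulVec_transpose,
          ← conjTranspose_eq_transpose_of_trivial, hN.eq]
      simp only [star_trivial, sub_mulVec, smul_mulVec, one_mulVec, dotProduct_sub,
        dotProduct_smul, smul_eq_mul, e]
      linarith
  have := trace_mul_nonneg hps hP
  rw [Matrix.sub_mul, trace_sub, smul_mul_assoc, Matrix.one_mul, trace_smul, smul_eq_mul] at this
  linarith

/-- One step of the matrix multiplicative weights method. -/
theorem trace_exp_add_le {A N : Matrix V V ℝ} (hA : A.IsHermitian) (hN : N.IsHermitian) {c : ℝ}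
    (h : spectralNorm N ≤ c) (hc : c ^ 2 ≤ 1 / 4) (hle : (N * NormedSpace.exp A).trace ≤ 0) :
    (NormedSpace.exp (A + N)).trace ≤ (1 + c ^ 2) * (NormedSpace.exp A).trace := by
  have h1 := trace_exp_sub_le (hA.add hN) hA
  have h2 := trace_mul_self_mul_le hN h (posDef_exp (hA.add hN)).posSemidef
  have h3 := trace_mul_self_mul_le hN h (posDef_exp hA).posSemidef
  have p3 := (posDef_exp hA).posSemidef.trace_nonneg
  rw [add_sub_cancel_left] at h1
  have h4 : (1 - c ^ 2 / 4) * (NormedSpace.exp (A + N)).trace ≤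
      (1 + c ^ 2 / 2) * (NormedSpace.exp A).trace := by linarith
  -- With `s = c²`, `(1 - s/4)(1 + s) - (1 + s/2) = (s - s²)/4`, nonnegative for `s ≤ 1`.
  have h5 : (1 + c ^ 2 / 2) * (NormedSpace.exp A).trace ≤
      (1 - c ^ 2 / 4) * ((1 + c ^ 2) * (NormedSpace.exp A).trace) := by
    rw [← mul_assoc]
    refine mul_le_mul_of_nonneg_right ?_ p3
    nlinarith [sq_nonneg c]
  exact le_of_mul_le_mul_left (h4.trans h5) (by linarith)

/-- The exponential of any one eigenvalue is at most the sum of all of them. -/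
theorem posSemidef_of_trace_exp_le {A : Matrix V V ℝ} (hA : A.IsHermitian) {c : ℝ}
    (h : (NormedSpace.exp A).trace ≤ Real.exp c) : (c • (1 : Matrix V V ℝ) - A).PosSemidef := by
  obtain ⟨U, a, hU, rfl⟩ := exists_eq_conjDiag hA
  rw [← conjDiag_const hU, conjDiag_sub]
  refine posSemidef_conjDiag fun i => sub_nonneg.2 (Real.exp_le_exp.1 (le_trans ?_ h))
  rw [exp_conjDiag hU, conjDiag, Matrix.trace_mul_comm, ← Matrix.mul_assoc, hU, Matrix.one_mul,
    trace_diagonal]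
  exact Finset.single_le_sum (f := fun i => Real.exp (a i)) (fun _ _ => (Real.exp_pos _).le)
    (Finset.mem_univ i)

end SpectralCalculus

/-! ### The constraint matrices: symmetry, kernel and quadratic forms -/

section Bullet

variable {V : Type*} [Fintype V] [DecidableEq V]

theorem bullet_add_left (A B X : Matrix V V ℝ) : bullet (A + B) X = bullet A X + bullet B X := by
  simp [bullet, Matrix.add_mul]

theorem bullet_sub_left (A B X : Matrix V V ℝ) : bullet (A - B) X = bullet A X - bullet B X := by
  simp [bullet, Matrix.sub_mul]

theorem bullet_smul_left (c : ℝ) (A X : Matrix V V ℝ) : bullet (c • A) X = c * bullet A X := by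
  simp [bullet]

theorem bullet_smul_right (c : ℝ) (A X : Matrix V V ℝ) : bullet A (c • X) = c * bullet A X := by
  simp [bullet]

theorem bullet_sum_left {ι : Type*} (s : Finset ι) (A : ι → Matrix V V ℝ) (X : Matrix V V ℝ) :
    bullet (∑ i ∈ s, A i) X = ∑ i ∈ s, bullet (A i) X := by
  simp [bullet, transpose_sum, Finset.sum_mul, trace_sum]

theorem bullet_of_isHermitian {A : Matrix V V ℝ} (hA : A.IsHermitian) (X : Matrix V V ℝ) :
    bullet A X = (A * X).trace := by
  rw [bullet, ← conjTranspose_eq_transpose_of_trivial, hA.eq]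

theorem bullet_sqDistMatrix_eq (i j : V) (X : Matrix V V ℝ) :
    bullet (sqDistMatrix i j) X = X i i - X i j - X j i + X j j := by
  rw [bullet, sqDistMatrix, Matrix.transpose_vecMulVec, Matrix.vecMulVec_mul,
    Matrix.trace_vecMulVec, dotProduct_comm, ← Matrix.dotProduct_mulVec]
  simp [Matrix.mulVec_sub, sub_dotProduct]
  ring

/-- The weighted variance identity; the subtracted term vanishes once the weighted mean is at the
origin. -/
theorem bullet_demandMatrix (ω : V → ℝ) (X : Matrix V V ℝ) :
    bullet (demandMatrix ω) X = (∑ i, ω i) * ∑ i, ω i * X i i - ω ⬝ᵥ X *ᵥ ω := by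
  have h1 : ∑ i, ∑ j, ω i * ω j * X i i = (∑ i, ω i) * ∑ i, ω i * X i i := by
    rw [mul_comm, Finset.sum_mul_sum]
    exact Finset.sum_congr rfl fun i _ => Finset.sum_congr rfl fun j _ => by ring
  have h2 : ∑ i, ∑ j, ω i * ω j * X j j = (∑ i, ω i) * ∑ i, ω i * X i i := by
    rw [Finset.sum_mul_sum]
    exact Finset.sum_congr rfl fun i _ => Finset.sum_congr rfl fun j _ => by ring
  have h3 : ∑ i, ∑ j, ω i * ω j * X i j = ω ⬝ᵥ X *ᵥ ω := by
    simp only [dotProduct, mulVec, Finset.mul_sum]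
    exact Finset.sum_congr rfl fun i _ => Finset.sum_congr rfl fun j _ => by ring
  have h4 : ∑ i, ∑ j, ω i * ω j * X j i = ω ⬝ᵥ X *ᵥ ω := by
    rw [Finset.sum_comm, ← h3]
    exact Finset.sum_congr rfl fun i _ => Finset.sum_congr rfl fun j _ => by ring
  simp only [demandMatrix, bullet_smul_left, bullet_sum_left, bullet_sqDistMatrix_eq, mul_add,
    mul_sub, Finset.sum_add_distrib, Finset.sum_sub_distrib, h1, h2, h3, h4]
  ring

theorem isHermitian_sqDistMatrix (i j : V) : (sqDistMatrix i j).IsHermitian := by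
  rw [IsHermitian, conjTranspose_eq_transpose_of_trivial, sqDistMatrix, transpose_vecMulVec]

theorem sqDistMatrix_mulVec_one (i j : V) : sqDistMatrix i j *ᵥ 1 = 0 := by
  simp [sqDistMatrix, vecMulVec_mulVec, sub_dotProduct]

theorem isHermitian_triMatrix (p : Triple V) : (triMatrix p).IsHermitian := by
  obtain ⟨⟨q, j⟩, hp⟩ := p
  induction q with
  | h i k =>
    exact ((isHermitian_sqDistMatrix i j).add (isHermitian_sqDistMatrix j k)).sub
      (isHermitian_sqDistMatrix i k)

theorem triMatrix_mulVec_one (p : Triple V) : triMatrix p *ᵥ 1 = 0 := by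
  obtain ⟨⟨q, j⟩, hp⟩ := p
  induction q with
  | h i k =>
    change (sqDistMatrix i j + sqDistMatrix j k - sqDistMatrix i k) *ᵥ 1 = 0
    simp [sub_mulVec, add_mulVec, sqDistMatrix_mulVec_one]

theorem isHermitian_demandMatrix (ω : V → ℝ) : (demandMatrix ω).IsHermitian :=
  IsSelfAdjoint.smul (.all _) (isSelfAdjoint_sum _ fun i _ => isSelfAdjoint_sum _ fun j _ =>
    IsSelfAdjoint.smul (.all _) (isHermitian_sqDistMatrix i j))

theorem demandMatrix_mulVec_one (ω : V → ℝ) : demandMatrix ω *ᵥ 1 = 0 := by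
  simp [demandMatrix, smul_mulVec, sum_mulVec, sqDistMatrix_mulVec_one]

theorem DualSolution.isHermitian_slack (ω : V → ℝ) {D : DualSolution V} (hF : D.F.IsSymm) :
    (D.slack ω).IsHermitian := by
  refine IsSelfAdjoint.sub (IsSelfAdjoint.add (isSelfAdjoint_sum _ fun p _ =>
    IsSelfAdjoint.smul (.all _) (isHermitian_triMatrix p))
    (IsSelfAdjoint.smul (.all _) (isHermitian_demandMatrix ω))) ?_
  exact (conjTranspose_eq_transpose_of_trivial _).trans hF

theorem DualSolution.slack_mulVec_one (ω : V → ℝ) {D : DualSolution V} (hF : D.F *ᵥ 1 = 0) :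
    D.slack ω *ᵥ 1 = 0 := by
  simp [DualSolution.slack, sub_mulVec, add_mulVec, sum_mulVec, smul_mulVec,
    triMatrix_mulVec_one, demandMatrix_mulVec_one, hF]

/-- Makes the normalization of the primal candidates legitimate. -/
theorem bullet_demandMatrix_pos [Nontrivial V] {ω : V → ℝ} (hω : ∀ i, 0 < ω i)
    {X : Matrix V V ℝ} (hX : X.PosDef) : 0 < bullet (demandMatrix ω) X := by
  have hpos : ∀ i j : V, i ≠ j → 0 < bullet (sqDistMatrix i j) X := fun i j hij => by
    have hne : (Pi.single i 1 - Pi.single j 1 : V → ℝ) ≠ 0 := fun h => by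
      simpa [hij] using congrFun h i
    have := hX.dotProduct_mulVec_pos hne
    rw [bullet_sqDistMatrix_eq]
    simp [mulVec_sub, sub_dotProduct] at this
    linarith
  have hnn : ∀ i j : V, 0 ≤ bullet (sqDistMatrix i j) X := fun i j => by
    rcases eq_or_ne i j with rfl | hij
    · rw [bullet_sqDistMatrix_eq]; linarith
    · exact (hpos i j hij).le
  obtain ⟨i, j, hij⟩ := exists_pair_ne V
  simp only [demandMatrix, bullet_smul_left, bullet_sum_left]
  refine mul_pos (by norm_num) (Finset.sum_pos' (fun a _ => Finset.sum_nonneg fun b _ => ?_)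
    ⟨i, Finset.mem_univ _, Finset.sum_pos' (fun b _ => ?_) ⟨j, Finset.mem_univ _, ?_⟩⟩)
  · exact mul_nonneg (mul_pos (hω _) (hω _)).le (hnn _ _)
  · exact mul_nonneg (mul_pos (hω _) (hω _)).le (hnn _ _)
  · exact mul_pos (mul_pos (hω _) (hω _)) (hpos _ _ hij)

end Bullet

/-! ### Translation to the weighted mean -/

section Centering

variable {V : Type*} [Fintype V] [DecidableEq V]

/-- The matrix that subtracts from each vector the weighted average of all of them. -/
def centerMatrix (ω : V → ℝ) : Matrix V V ℝ := 1 - (∑ i, ω i)⁻¹ • vecMulVec 1 ω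

/-- The Gram matrix of the vectors with Gram matrix `X` after their weighted average
has been moved to the origin. -/
def centered (ω : V → ℝ) (X : Matrix V V ℝ) : Matrix V V ℝ :=
  centerMatrix ω * X * (centerMatrix ω)ᵀ

theorem posSemidef_centered (ω : V → ℝ) {X : Matrix V V ℝ} (hX : X.PosSemidef) :
    (centered ω X).PosSemidef := by
  have := hX.mul_mul_conjTranspose_same (centerMatrix ω)
  rwa [conjTranspose_eq_transpose_of_trivial] at this

theorem centered_mulVec {ω : V → ℝ} (hω : ∑ i, ω i ≠ 0) (X : Matrix V V ℝ) :
    centered ω X *ᵥ ω = 0 := by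
  have h : (centerMatrix ω)ᵀ *ᵥ ω = 0 := by
    rw [centerMatrix, transpose_sub, transpose_smul, transpose_vecMulVec, transpose_one,
      sub_mulVec, smul_mulVec, vecMulVec_mulVec, one_mulVec, one_dotProduct]
    ext i
    simp [hω, mul_comm (ω i)]
  rw [centered, ← mulVec_mulVec, h, mulVec_zero]

/-- A symmetric matrix that kills the all-ones vector does not see translations of the Gram vectors.
-/
theorem bullet_centered (ω : V → ℝ) {N : Matrix V V ℝ} (hN : N.IsHermitian) (h1 : N *ᵥ 1 = 0)
    (X : Matrix V V ℝ) : bullet N (centered ω X) = bullet N X := by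
  have hr : N * centerMatrix ω = N := by
    rw [centerMatrix, Matrix.mul_sub, Matrix.mul_one, Matrix.mul_smul, mul_vecMulVec, h1,
      zero_vecMulVec, smul_zero, sub_zero]
  have hl : (centerMatrix ω)ᵀ * N = N := by
    have := congrArg transpose hr
    rwa [transpose_mul, ← conjTranspose_eq_transpose_of_trivial N, hN.eq] at this
  rw [bullet_of_isHermitian hN, bullet_of_isHermitian hN, centered, ← Matrix.mul_assoc,
    ← Matrix.mul_assoc, hr, Matrix.trace_mul_comm, ← Matrix.mul_assoc, hl]

/-- After centering, `K • X = 1` reads `W * ∑ ω i * Y i i = 1` for the centered matrix `Y`, and `ω i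
≥ 1`. -/
theorem trace_centered_le {ω : V → ℝ} (hω : ∀ i, 1 ≤ ω i) (hW : 0 < ∑ i, ω i)
    {X : Matrix V V ℝ} (hX : X.PosSemidef) (hK : bullet (demandMatrix ω) X = 1) :
    (centered ω X).trace ≤ (∑ i, ω i)⁻¹ := by
  have h := bullet_centered ω (isHermitian_demandMatrix ω) (demandMatrix_mulVec_one ω) X
  rw [hK, bullet_demandMatrix, centered_mulVec hW.ne', dotProduct_zero, sub_zero] at h
  rw [← eq_inv_of_mul_eq_one_right h]
  refine Finset.sum_le_sum fun i _ => ?_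
  exact le_mul_of_one_le_left (posSemidef_centered ω hX).diag_nonneg (hω i)

theorem bullet_le_of_posSemidef {ω : V → ℝ} (hω : ∀ i, 1 ≤ ω i) (hW : 0 < ∑ i, ω i)
    {X N : Matrix V V ℝ} (hX : X.PosSemidef) (hK : bullet (demandMatrix ω) X = 1)
    (hN : N.IsHermitian) (h1 : N *ᵥ 1 = 0) {c : ℝ} (hc : 0 ≤ c)
    (hcN : (c • (1 : Matrix V V ℝ) - N).PosSemidef) : bullet N X ≤ c / ∑ i, ω i := by
  have h := trace_mul_nonneg hcN (posSemidef_centered ω hX)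
  rw [Matrix.sub_mul, trace_sub, smul_mul_assoc, Matrix.one_mul, trace_smul, smul_eq_mul,
    ← bullet_of_isHermitian hN, bullet_centered ω hN h1] at h
  have := mul_le_mul_of_nonneg_left (trace_centered_le hω hW hX hK) hc
  rw [div_eq_mul_inv]
  linarith

end Centering

/-! ### Analysis of the primal-dual algorithm -/

section Algorithm

variable {V E : Type*} [Fintype V] [DecidableEq V] [Fintype E]

theorem weightMatrix_eq (ω : V → ℝ) (ρ η : ℝ) (D : ℕ → DualSolution V) (t : ℕ) :
    weightMatrix ω ρ η D t =
      NormedSpace.exp ((η / ρ) • ∑ s ∈ Finset.range t, (D s).slack ω) := by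
  simp only [weightMatrix, lossMatrix, ← Finset.smul_sum, smul_smul, ← neg_smul]
  congr 2
  ring

theorem DirectedHypergraph.objective_inducedDist_le (H : DirectedHypergraph V E) {ω : V → ℝ}
    {o : V} {X : Matrix V V ℝ} {d : E → ℝ} (h : H.SDPFeasible ω o X d) :
    H.objective (H.inducedDist o X) ≤ H.objective d := by
  refine mul_le_mul_of_nonneg_left (Finset.sum_le_sum fun e _ =>
    mul_le_mul_of_nonneg_left (max_le (h.nonneg e) (Finset.sup'_le _ _ fun q hq => ?_))
      (H.w_nonneg e)) (by norm_num)
  rw [Finset.mem_product] at hq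
  linarith [h.dist_le e q.1 hq.1 q.2 hq.2]

/-- Weak duality: the triangle terms are nonnegative, `z * (K • X) = z ≥ α`, and `F • X` is at most
the objective of the least admissible distances. -/
theorem DirectedHypergraph.GoodDual.sub_objective_le {H : DirectedHypergraph V E} {ω : V → ℝ}
    {o : V} {α ρ : ℝ} {X Y : Matrix V V ℝ} {D : DualSolution V} (hD : H.GoodDual ω o α ρ Y D)
    {d : E → ℝ} (h : H.SDPFeasible ω o X d) :
    α - H.objective d ≤ bullet (D.slack ω) X := by
  have h1 := hD.F_le X h.primal
  have h2 := H.objective_inducedDist_le h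
  have h3 : 0 ≤ ∑ p, D.f p * bullet (triMatrix p) X :=
    Finset.sum_nonneg fun p _ => mul_nonneg (hD.f_nonneg p) (h.primal.triangle p)
  have h4 := hD.z_ge
  simp only [DualSolution.slack, bullet_sub_left, bullet_add_left, bullet_sum_left,
    bullet_smul_left, h.primal.sum_one]
  linarith

theorem DirectedHypergraph.GoodDual.isHermitian_slack {H : DirectedHypergraph V E} {ω : V → ℝ}
    {o : V} {α ρ : ℝ} {Y : Matrix V V ℝ} {D : DualSolution V} (hD : H.GoodDual ω o α ρ Y D) :
    (D.slack ω).IsHermitian :=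
  DualSolution.isHermitian_slack ω hD.F_symm

theorem DirectedHypergraph.GoodDual.slack_mulVec_one {H : DirectedHypergraph V E} {ω : V → ℝ}
    {o : V} {α ρ : ℝ} {Y : Matrix V V ℝ} {D : DualSolution V} (hD : H.GoodDual ω o α ρ Y D) :
    D.slack ω *ᵥ 1 = 0 :=
  DualSolution.slack_mulVec_one ω (hD.F_ones 1 (Submodule.mem_span_singleton_self 1))

theorem isHermitian_smul_sum_slack {ω : V → ℝ} {D : ℕ → DualSolution V} {t : ℕ}
    (h : ∀ s < t, ((D s).slack ω).IsHermitian) (c : ℝ) :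
    (c • ∑ s ∈ Finset.range t, (D s).slack ω).IsHermitian :=
  IsSelfAdjoint.smul (.all _) (isSelfAdjoint_sum _ fun s hs => h s (Finset.mem_range.1 hs))

/-- All answers of an oracle of width `ρ` in a run without subsets are good, because the
candidates it is run on are positive semidefinite and normalized. -/
theorem IsSubsetFreeRun.goodDual [Nontrivial V] {H : DirectedHypergraph V E} {ω : V → ℝ}
    (hω : ∀ i, 0 < ω i) {o : V} {κ C α ρ : ℝ} {O : Oracle V} (hO : H.HasWidth ω o κ C α ρ O)
    {T : ℕ} {D : ℕ → DualSolution V} (hD : IsSubsetFreeRun ω ρ O T D) (t : ℕ) (ht : t < T) :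
    H.GoodDual ω o α ρ (primalCandidate ω ρ (stepSize V T) D t) (D t) ∧
      0 < bullet (demandMatrix ω) (weightMatrix ω ρ (stepSize V T) D t) := by
  -- The candidate is a valid oracle input only if all earlier slacks are symmetric, hence only if
  -- all earlier answers are good.
  induction t using Nat.strong_induction_on with
  | _ t ih =>
    have hW : (weightMatrix ω ρ (stepSize V T) D t).PosDef := by
      rw [weightMatrix_eq]
      exact posDef_exp (isHermitian_smul_sum_slack
        (fun s hs => (ih s hs (hs.trans ht)).1.isHermitian_slack) _)
    have hpos := bullet_demandMatrix_pos hω hW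
    refine ⟨(hO _ (hW.posSemidef.smul (inv_nonneg.2 hpos.le)) ?_).2.2 _ (hD t ht), hpos⟩
    rw [bullet_smul_right, inv_mul_cancel₀ hpos.ne']

theorem spectralNorm_smul (c : ℝ) (A : Matrix V V ℝ) :
    spectralNorm (c • A) = |c| * spectralNorm A := by
  rw [spectralNorm, map_smul, norm_smul, Real.norm_eq_abs, spectralNorm]

/-- The potential function argument of the matrix multiplicative weights method. -/
theorem trace_weightMatrix_le {H : DirectedHypergraph V E} {ω : V → ℝ} {o : V} {α ρ η : ℝ}
    (hρ : 0 < ρ) (hη : 0 ≤ η) (hη' : η ^ 2 ≤ 1 / 4) {T : ℕ} {D : ℕ → DualSolution V}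
    (hD : ∀ t < T, H.GoodDual ω o α ρ (primalCandidate ω ρ η D t) (D t) ∧
      0 < bullet (demandMatrix ω) (weightMatrix ω ρ η D t)) (t : ℕ) (ht : t ≤ T) :
    (weightMatrix ω ρ η D t).trace ≤ (1 + η ^ 2) ^ t * Fintype.card V := by
  induction t with
  | zero => simp [weightMatrix, trace_one]
  | succ t ih =>
    obtain ⟨hg, hpos⟩ := hD t ht
    have hN := hg.isHermitian_slack
    -- The oracle's inequality is homogeneous, so it passes from the normalized candidate to the
    -- weight matrix.
    have hle : bullet ((D t).slack ω) (weightMatrix ω ρ η D t) ≤ 0 := by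
      have h := hg.bullet_le
      rw [← sub_nonpos, ← bullet_sub_left, primalCandidate, bullet_smul_right] at h
      exact nonpos_of_mul_nonpos_right h (inv_pos.2 hpos)
    have step := trace_exp_add_le
      (isHermitian_smul_sum_slack (t := t) (fun s hs => (hD s (hs.trans ht)).1.isHermitian_slack)
        (η / ρ))
      (N := (η / ρ) • (D t).slack ω) (IsSelfAdjoint.smul (.all (η / ρ)) hN) (c := η) ?_ hη' ?_
    · rw [← smul_add, ← Finset.sum_range_succ, ← weightMatrix_eq, ← weightMatrix_eq] at step
      refine step.trans ?_
      rw [pow_succ' (1 + η ^ 2), mul_assoc]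
      exact mul_le_mul_of_nonneg_left (ih (Nat.le_of_succ_le ht)) (by positivity)
    · rw [spectralNorm_smul, abs_of_nonneg (by positivity)]
      calc η / ρ * spectralNorm ((D t).slack ω) ≤ η / ρ * ρ :=
            mul_le_mul_of_nonneg_left hg.norm_le (by positivity)
        _ = η := by field_simp
    · rw [smul_mul_assoc, trace_smul, smul_eq_mul, ← weightMatrix_eq, ← bullet_of_isHermitian hN]
      exact mul_nonpos_of_nonneg_of_nonpos (by positivity) hle

/-- The step size satisfies `η² T = ln n` and `η ≤ α W / (4 ρ)`. -/
theorem stepSize_numIter [Nontrivial V] {ω : V → ℝ} {κ α ρ : ℝ} (hω : IsSkewed κ ω) (hα : 0 < α)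
    (hρ : 0 < ρ) :
    0 < numIter ω κ α ρ ∧ 0 < stepSize V (numIter ω κ α ρ) ∧
      stepSize V (numIter ω κ α ρ) ^ 2 * numIter ω κ α ρ = Real.log (Fintype.card V) ∧
      4 * ρ * stepSize V (numIter ω κ α ρ) ≤ α * ∑ i, ω i := by
  have hL : 0 < Real.log (Fintype.card V) :=
    Real.log_pos (by exact_mod_cast Fintype.one_lt_card)
  have hn : 0 < (Fintype.card V : ℝ) := by exact_mod_cast Fintype.card_pos
  obtain ⟨i₀⟩ : Nonempty V := inferInstance
  have hκ : 0 < κ := by linarith [(hω i₀).1, (hω i₀).2]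
  have hW : 0 < ∑ i, ω i :=
    Finset.sum_pos (fun i _ => by linarith [(hω i).1]) Finset.univ_nonempty
  have hWle : ∑ i, ω i ≤ κ * Fintype.card V := by
    calc ∑ i, ω i ≤ ∑ _i : V, κ := Finset.sum_le_sum fun i _ => (hω i).2
      _ = κ * Fintype.card V := by simp [mul_comm]
  set W := ∑ i, ω i with hWdef
  set L := Real.log (Fintype.card V)
  set T := numIter ω κ α ρ with hT
  have hTle : 16 * κ ^ 2 * ρ ^ 2 * (Fintype.card V : ℝ) ^ 2 * L / (α ^ 2 * W ^ 4) ≤ T :=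
    Nat.le_ceil _
  have hTpos : 0 < (T : ℝ) := lt_of_lt_of_le (by positivity) hTle
  have hsq : stepSize V T ^ 2 = L / T := Real.sq_sqrt (by positivity)
  refine ⟨by exact_mod_cast hTpos, Real.sqrt_pos.2 (by positivity), ?_, ?_⟩
  · rw [hsq]; field_simp
  · refine abs_le_of_sq_le_sq' ?_ (by positivity) |>.2
    rw [mul_pow, hsq, mul_div_assoc', div_le_iff₀ hTpos]
    rw [div_le_iff₀ (by positivity)] at hTle
    -- The choice of `T` gives `16 ρ² η² ≤ α² W⁴ / (κ n)²`; the bound `W ≤ κ n` removes two powers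
    -- of `W`.
    have h1 : W ^ 2 ≤ κ ^ 2 * (Fintype.card V : ℝ) ^ 2 := by
      rw [← mul_pow]; exact pow_le_pow_left₀ hW.le hWle 2
    have h2 := mul_le_mul_of_nonneg_left h1 (by positivity : 0 ≤ 16 * ρ ^ 2 * L)
    refine le_of_mul_le_mul_left ?_ (by positivity : 0 < W ^ 2)
    nlinarith

theorem half_le_objective [Nontrivial V] {H : DirectedHypergraph V E} {ω : V → ℝ} {κ : ℝ}
    (hω : IsSkewed κ ω) {o : V} {α ρ C : ℝ} (hα : 0 < α) (hρ : 0 < ρ) {O : Oracle V}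
    (hO : H.HasWidth ω o κ C α ρ O) {D : ℕ → DualSolution V}
    (hD : IsSubsetFreeRun ω ρ O (numIter ω κ α ρ) D) {X : Matrix V V ℝ} {d : E → ℝ}
    (h : H.SDPFeasible ω o X d) : α / 2 ≤ H.objective d := by
  have hω1 : ∀ i, 1 ≤ ω i := fun i => (hω i).1
  have hω0 : ∀ i, 0 < ω i := fun i => zero_lt_one.trans_le (hω1 i)
  have hW : 0 < ∑ i, ω i := Finset.sum_pos (fun i _ => hω0 i) Finset.univ_nonempty
  obtain ⟨hT, hη, hηT, hηle⟩ := stepSize_numIter hω hα hρ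
  have hgood := hD.goodDual hω0 hO
  set T := numIter ω κ α ρ
  set η := stepSize V T
  set W := ∑ i, ω i
  have hT' : (0 : ℝ) < T := by exact_mod_cast hT
  -- For small `ρ` the first answer already suffices, by its norm bound. Otherwise `4 ρ η ≤ α W < 2
  -- ρ` yields the `η ≤ 1/2` that the potential argument needs.
  rcases le_or_gt ρ (α * W / 2) with hcase | hcase
  · obtain ⟨hg, -⟩ := hgood 0 hT
    have h1 := hg.sub_objective_le h
    have h2 := bullet_le_of_posSemidef hω1 hW h.primal.posSemidef h.primal.sum_one
      hg.isHermitian_slack hg.slack_mulVec_one hρ.le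
      (posSemidef_smul_one_sub hg.isHermitian_slack hg.norm_le)
    have h3 : ρ / W ≤ α / 2 := by rw [div_le_iff₀ hW]; linarith
    linarith
  · have hη2 : η ^ 2 ≤ 1 / 4 := by
      have : η ≤ 1 / 2 := by
        refine le_of_mul_le_mul_left ?_ (by positivity : 0 < 4 * ρ)
        linarith
      nlinarith
    have htr := trace_weightMatrix_le hρ hη.le hη2 hgood T le_rfl
    have hn : (0 : ℝ) < Fintype.card V := by exact_mod_cast Fintype.card_pos
    -- One factor `exp (η² T)` bounds `(1 + η²) ^ T`; the other equals `n`, the initial trace.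
    have htr' : (weightMatrix ω ρ η D T).trace ≤ Real.exp (2 * (η ^ 2 * T)) := by
      refine htr.trans ?_
      rw [two_mul, Real.exp_add]
      nth_rewrite 2 [hηT]
      rw [Real.exp_log hn, mul_comm (η ^ 2), Real.exp_nat_mul]
      refine mul_le_mul_of_nonneg_right (pow_le_pow_left₀ (by positivity) ?_ T) hn.le
      linarith [Real.add_one_le_exp (η ^ 2)]
    have hS := isHermitian_smul_sum_slack (t := T)
      (fun s hs => (hgood s hs).1.isHermitian_slack) (η / ρ)
    rw [weightMatrix_eq] at htr'
    have hS1 : ((η / ρ) • ∑ s ∈ Finset.range T, (D s).slack ω) *ᵥ 1 = 0 := by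
      rw [smul_mulVec, sum_mulVec, Finset.sum_eq_zero, smul_zero]
      exact fun s hs => (hgood s (Finset.mem_range.1 hs)).1.slack_mulVec_one
    have hub := bullet_le_of_posSemidef hω1 hW h.primal.posSemidef h.primal.sum_one hS hS1
      (by positivity) (posSemidef_of_trace_exp_le hS htr')
    have hlb : T * (α - H.objective d) ≤ ∑ s ∈ Finset.range T, bullet ((D s).slack ω) X := by
      simpa [mul_sub] using Finset.sum_le_sum fun s hs =>
        (hgood s (Finset.mem_range.1 hs)).1.sub_objective_le h
    rw [bullet_smul_left, bullet_sum_left] at hub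
    have hfin := (mul_le_mul_of_nonneg_left hlb (by positivity : 0 ≤ η / ρ)).trans hub
    have h1 : α - H.objective d ≤ 2 * η * ρ / W := by
      refine le_of_mul_le_mul_left ?_ (by positivity : 0 < η / ρ * T)
      calc η / ρ * T * (α - H.objective d) ≤ 2 * (η ^ 2 * T) / W := by linarith
        _ = η / ρ * T * (2 * η * ρ / W) := by field_simp
    have h2 : 2 * η * ρ / W ≤ α / 2 := by rw [div_le_iff₀ hW]; linarith
    linarith

/-- With one vertex `K = 0`, so `K • X = 1` is impossible and the infimum is `⊤`. -/
theorem not_sdpFeasible_of_subsingleton [Subsingleton V] (H : DirectedHypergraph V E)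
    (ω : V → ℝ) (o : V) (X : Matrix V V ℝ) (d : E → ℝ) : ¬ H.SDPFeasible ω o X d := fun h => by
  have hK : demandMatrix ω = 0 := by
    rw [demandMatrix, Finset.sum_eq_zero, smul_zero]
    refine fun i _ => Finset.sum_eq_zero fun j _ => ?_
    rw [Subsingleton.elim i j, sqDistMatrix, sub_self, zero_vecMulVec, smul_zero]
  have := h.primal.sum_one
  simp [hK, bullet] at this

end Algorithm

end DirSparsestCut

end

theorem mainTheorem5 {V E : Type*} [Fintype V] [DecidableEq V] [Fintype E]
    (H : DirSparsestCut.DirectedHypergraph V E) (ω : V → ℝ) (κ : ℝ)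
    (hω : DirSparsestCut.IsSkewed κ ω) (o : V)
    (α ρ C : ℝ) (hα : 0 < α) (hρ : 0 < ρ)
    (O : DirSparsestCut.Oracle V) (hO : H.HasWidth ω o κ C α ρ O)
    (D : ℕ → DirSparsestCut.DualSolution V)
    (hD : DirSparsestCut.IsSubsetFreeRun ω ρ O (DirSparsestCut.numIter ω κ α ρ) D) :
    ((α / 2 : ℝ) : EReal) ≤ H.sdpValue ω o := by
  refine le_iInf fun X => le_iInf fun d => le_iInf fun h => ?_
  rcases subsingleton_or_nontrivial V with hV | hV
  · exact absurd h (DirSparsestCut.not_sdpFeasible_of_subsingleton H ω o X d)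
  · exact EReal.coe_le_coe_iff.2 (DirSparsestCut.half_le_objective hω hα hρ hO hD h)
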